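/- Let $0<\nu<1$, $\mu\ge 0$, $\lambda,\rho,\xi>0$. For $t,u>0$ let $$f_{\nu,\mu}(t;u)=\mathcal L^{-1}\Big\{\frac{e^{-u s^{\nu}}}{s^{\mu}}\Big\}(t)=\frac1{2\pi i}\int_{c-i\infty}^{c+i\infty}e^{st}\,\frac{e^{-us^{\nu}}}{s^{\mu}}\,ds ,$$ where $c>0$ is arbitrary and the powers are principal (so $f_{\nu,\mu}(t)=f_{\nu,\mu}(t;1)$). The Volterra functions are $$\nu(t)=\int_0^\infty\frac{t^{x}}{\Gamma(x+1)}dx,\qquad \nu(t,\alpha)=\int_0^\infty\frac{t^{x+\alpha}}{\Gamma(x+\alpha+1)}dx,\qquad \mu(t,\beta,\alpha)=\int_0^\infty\frac{x^{\beta}\,t^{x+\alpha}}{\Gamma(\beta+1)\Gamma(x+\alpha+1)}dx .$$ For real $a$ and a function $h$ on $(0,\infty)$, let $\frac{t^{a-1}}{\Gamma(a)}\star h(t)$ denote the Laplace convolution $\int_0^t\frac{(t-\tau)^{a-1}}{\Gamma(a)}h(\tau)\,d\tau$ if $a>0$, and, if $a\le 0$, the derivative $\frac{d^n}{dt^n}\int_0^t\frac{(t-\tau)^{a+n-1}}{\Gamma(a+n)}h(\tau)\,d\tau$,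 where $n$ is the least natural number with $a+n>0$. Then for every $t>0$ $$\int_0^\infty \nu(\lambda u)\,f_{\nu,\mu}(t;u)\,du=\frac1\nu\,\frac{t^{\nu+\mu-2}}{\Gamma(\nu+\mu-1)}\star\nu(\lambda^{1/\nu}t),$$ $$\int_0^\infty \nu(\lambda u,\rho)\,f_{\nu,\mu}(t;u)\,du=\frac1{\nu\lambda}\,\frac{t^{\mu-2}}{\Gamma(\mu-1)}\star\nu\big(\lambda^{1/\nu}t,(\rho+1)\nu\big),$$ $$\int_0^\infty \mu(\lambda u,\xi,\rho)\,f_{\nu,\mu}(t;u)\,du=\frac1{\lambda\,\nu^{\xi+1}}\,\frac{t^{\mu-2}}{\Gamma(\mu-1)}\star\mu\big(\lambda^{1/\nu}t,\xi,(\rho+1)\nu\big).$$ All integrals over $u$ converge absolutely, the convolution integrals converge, and the derivatives in the definition of $\star$ exist and are continuous on $(0,\infty)$. -/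

import Mathlib

open MeasureTheory Set

noncomputable section

/-- The Volterra function `ν(t) = ∫₀^∞ t^x / Γ(x+1) dx`. -/
def volterraNu (t : ℝ) : ℝ :=
  ∫ x in Ioi (0 : ℝ), t ^ x / Real.Gamma (x + 1)

/-- The Volterra function `ν(t, α) = ∫₀^∞ t^(x+α) / Γ(x+α+1) dx`. -/
def volterraNu₂ (t α : ℝ) : ℝ :=
  ∫ x in Ioi (0 : ℝ), t ^ (x + α) / Real.Gamma (x + α + 1)

/-- The Volterra function `μ(t, β, α) = ∫₀^∞ x^β t^(x+α) / (Γ(β+1) Γ(x+α+1)) dx`. -/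
def volterraMu (t β α : ℝ) : ℝ :=
  ∫ x in Ioi (0 : ℝ),
    x ^ β * t ^ (x + α) / (Real.Gamma (β + 1) * Real.Gamma (x + α + 1))

/-- The complex inversion integral `(1 / 2πi) ∫_{c-i∞}^{c+i∞} e^(st) F(s) ds`, with the line
parametrized as `s = c + iy`, `ds = i dy`. -/
def bromwich (c : ℝ) (F : ℂ → ℂ) (t : ℝ) : ℂ :=
  (1 / (2 * (Real.pi : ℂ) * Complex.I)) *
    ∫ y : ℝ, Complex.exp (((c : ℂ) + (y : ℂ) * Complex.I) * (t : ℂ)) *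
      F ((c : ℂ) + (y : ℂ) * Complex.I) * Complex.I

/-- `f_{ν,μ}(t; u)`, the inverse Laplace transform at `t` of `s ↦ e^(-u s^ν) / s^μ`, computed
along the line `Re s = c`. The function `f_{ν,μ}(t)` is the case `u = 1`. -/
def expInv (ν μ c t u : ℝ) : ℂ :=
  bromwich c (fun s : ℂ => Complex.exp (-((u : ℂ) * s ^ (ν : ℂ))) / s ^ (μ : ℂ)) t

/-- The Laplace convolution `(k ⋆ h)(t) = ∫₀^t k(t-τ) h(τ) dτ`. -/
def laplaceConv (k h : ℝ → ℝ) (t : ℝ) : ℝ :=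
  ∫ τ in (0 : ℝ)..t, k (t - τ) * h τ

/-- The power function `t^(a-1) / Γ(a)`. -/
def powerKernel (a t : ℝ) : ℝ :=
  t ^ (a - 1) / Real.Gamma a

/-- The least natural number `n` with `0 < a + n`. -/
def regOrder (a : ℝ) : ℕ :=
  if 0 < a then 0 else ⌊-a⌋₊ + 1

/-- The convolution `t^(a-1)/Γ(a) ⋆ h` for real `a`, in the sense of operational calculus
(multiplication of the transform by `s^(-a)`). For `a > 0` it is the Laplace convolution; for
`a ≤ 0` it is the `n`-th derivative of `t^(a+n-1)/Γ(a+n) ⋆ h`, with `n` least such that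
`a + n > 0`. -/
def powerConv (a : ℝ) (h : ℝ → ℝ) (t : ℝ) : ℝ :=
  iteratedDeriv (regOrder a) (laplaceConv (powerKernel (a + regOrder a)) h) t

/-- The convolution `t^(a-1)/Γ(a) ⋆ h` is meaningful at every `t > 0`: the convolution integral
converges and the derivatives needed exist (and are continuous). -/
def PowerConvExists (a : ℝ) (h : ℝ → ℝ) : Prop :=
  (∀ t : ℝ, 0 < t → IntervalIntegrable
    (fun τ => powerKernel (a + regOrder a) (t - τ) * h τ) volume 0 t) ∧
  ContDiffOn ℝ (regOrder a : ℕ) (laplaceConv (powerKernel (a + regOrder a)) h) (Ioi 0)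

theorem regOrder_pos (a : ℝ) : 0 < a + regOrder a := by
  unfold regOrder
  split_ifs with h
  · simpa using h
  · have := Nat.lt_floor_add_one (-a)
    push_cast
    linarith

theorem regOrder_le (a : ℝ) (n : ℕ) (hn : 0 < a + n) : regOrder a ≤ n := by
  unfold regOrder
  split_ifs with h
  · exact Nat.zero_le _
  · have : ⌊-a⌋₊ < n := (Nat.floor_lt (by linarith)).2 (by linarith)
    omega

theorem powerConv_of_pos {a : ℝ} (ha : 0 < a) (h : ℝ → ℝ) (t : ℝ) :
    powerConv a h t = ∫ τ in (0 : ℝ)..t, (t - τ) ^ (a - 1) / Real.Gamma a * h τ := by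
  simp [powerConv, regOrder, ha, laplaceConv, powerKernel]

end

/-! Each Volterra function at `κ * t` is a superposition `∫ w(x) t^(x+b) / Γ(x+b+1) dx` of
normalized powers, so both sides reduce to what happens to one power.

On the right, `⋆` with order `a` sends `t^z / Γ(z+1)` to `t^(z+a) / Γ(z+a+1)`: the Beta integral
raises the exponent, and each derivative lowers it by one. Hence `powerConv a` merely shifts the
index `b` by `a` (`ExpWeight.powerConv_weightedVolterra`).

On the left, the moment formula `∫ u^p f(t;u) du = Γ(p+1) t^(q-1) / Γ(q)`, `q = μ + ν(p+1)`, turns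
the superposition in `u` into one in `t` with exponents `ν(x+b+1) + μ - 1`
(`integral_rpow_mul_expInv`); the substitution `x ↦ x/ν` restores the standard form. It remains to
compare weights.

The analytic burden is Fubini. The double integrals over `u` and the vertical line converge
absolutely only for `q > 1`, and the crude bounds on `f` are too singular at `u = 0`. Both defects
are cured by integrating by parts along the line, `t f_m = uν f_(m+1-ν) + m f_(m+1)` (`mul_expInv`).
Moving the line to the right gives decay of `f` in `u` faster than any exponential, which beats the
growth of the Volterra functions (`exists_norm_expInv_le`). -/

noncomputable section

/-! ### Superpositions of normalized powers: growth and regularity. -/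

/-- A function on the half-line of at most exponential growth, in the mean. -/
def ExpWeight (w : ℝ → ℝ) : Prop :=
  ∃ r : ℝ, IntegrableOn (fun x => w x * Real.exp (-r * x)) (Ioi 0)

/-- The weighted Volterra function `∫₀^∞ w(x) t^(x+b) / Γ(x+b+1) dx`. -/
def weightedVolterra (w : ℝ → ℝ) (b t : ℝ) : ℝ :=
  ∫ x in Ioi (0 : ℝ), w x * (t ^ (x + b) / Real.Gamma (x + b + 1))

/-- Keep only the part of the Gamma integral over `(B, ∞)`, where the power is at least `B ^ z`. The
free parameter `B` is what later yields an arbitrary exponential rate. -/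
theorem rpow_mul_exp_neg_le_Gamma {z B : ℝ} (hz : 0 ≤ z) (hB : 0 < B) :
    B ^ z * Real.exp (-B) ≤ Real.Gamma (z + 1) := by
  have hint := Real.GammaIntegral_convergent (s := z + 1) (by linarith)
  rw [Real.Gamma_eq_integral (by linarith)]
  calc B ^ z * Real.exp (-B) = ∫ x in Ioi B, B ^ z * Real.exp (-x) := by
        rw [integral_const_mul, integral_exp_neg_Ioi]
    _ ≤ ∫ x in Ioi B, Real.exp (-x) * x ^ (z + 1 - 1) := by
        refine setIntegral_mono_on ((exp_neg_integrableOn_Ioi B one_pos).congr_fun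
          (fun x _ => by simp) measurableSet_Ioi |>.const_mul _)
          (hint.mono_set (Ioi_subset_Ioi hB.le)) measurableSet_Ioi fun x hx => ?_
        rw [mul_comm, add_sub_cancel_right]
        gcongr
        exact le_of_lt hx
    _ ≤ ∫ x in Ioi 0, Real.exp (-x) * x ^ (z + 1 - 1) := by
        refine setIntegral_mono_set hint ?_ (Ioi_subset_Ioi hB.le).eventuallyLE
        filter_upwards [ae_restrict_mem measurableSet_Ioi] with x hx
        have : (0 : ℝ) < x := hx
        simp only [Pi.zero_apply]
        positivity

/-- For every rate `r`, the summand `t^z / Γ(z+1)` decays like `e^(-r z)`, locally uniformly. -/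
theorem rpow_div_Gamma_le {z t T : ℝ} (r : ℝ) (hz : 0 ≤ z) (ht : 0 < t) (htT : t ≤ T) :
    t ^ z / Real.Gamma (z + 1) ≤ Real.exp (-r * z) * Real.exp (T * Real.exp r) := by
  -- With `B = t * exp r`, the factor `B ^ z` is `t ^ z * exp (r * z)`.
  have hG := rpow_mul_exp_neg_le_Gamma hz (B := t * Real.exp r) (by positivity)
  rw [div_le_iff₀ (Real.Gamma_pos_of_pos (by linarith))]
  calc t ^ z = Real.exp (-r * z) * Real.exp (t * Real.exp r) *
        ((t * Real.exp r) ^ z * Real.exp (-(t * Real.exp r))) := by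
        rw [Real.mul_rpow ht.le (Real.exp_pos _).le, ← Real.exp_mul]
        have h1 : Real.exp (-r * z) * Real.exp (r * z) = 1 := by
          rw [← Real.exp_add]; simp
        have h2 : Real.exp (t * Real.exp r) * Real.exp (-(t * Real.exp r)) = 1 := by
          rw [← Real.exp_add]; simp
        linear_combination (-t ^ z) * h1 - t ^ z * Real.exp (-r * z) * Real.exp (r * z) * h2
    _ ≤ _ := by gcongr

/-- Exponents in `(-1, 0)` occur because the final index `ν * (b + 1) + μ - 1` may be negative. The
previous bound is applied at `z + 1`; the factor `z + 1` from the functional equation of Gamma is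
absorbed by raising the rate to `r + 1`. -/
theorem rpow_div_Gamma_le' {z t t₀ T : ℝ} (r : ℝ) (hz : -1 < z) (ht₀ : 0 < t₀) (ht : t₀ ≤ t)
    (htT : t ≤ T) :
    t ^ z / Real.Gamma (z + 1) ≤
      Real.exp (-r * (z + 1)) * (Real.exp (T * Real.exp (r + 1)) / t₀) := by
  have htp : 0 < t := ht₀.trans_le ht
  have h := rpow_div_Gamma_le (r + 1) (by linarith : 0 ≤ z + 1) htp htT
  have hz1 : z + 1 ≠ 0 := by linarith
  have hΓ : 0 < Real.Gamma (z + 1) := Real.Gamma_pos_of_pos (by linarith)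
  calc t ^ z / Real.Gamma (z + 1)
      = (z + 1) * (t ^ (z + 1) / Real.Gamma (z + 1 + 1)) / t := by
        rw [Real.Gamma_add_one hz1, Real.rpow_add htp, Real.rpow_one]
        field_simp
    _ ≤ Real.exp (z + 1) * (Real.exp (-(r + 1) * (z + 1)) *
          Real.exp (T * Real.exp (r + 1))) / t₀ := by
        have := Real.add_one_le_exp (z + 1)
        have : 0 < Real.Gamma (z + 1 + 1) := Real.Gamma_pos_of_pos (by linarith)
        gcongr
        linarith
    _ = _ := by
        rw [← mul_assoc, ← Real.exp_add]
        ring_nf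

theorem ExpWeight.aestronglyMeasurable {w : ℝ → ℝ} (hw : ExpWeight w) :
    AEStronglyMeasurable w (volume.restrict (Ioi 0)) := by
  obtain ⟨r, hr⟩ := hw
  refine ((hr.aestronglyMeasurable.mul (g := fun x => Real.exp (r * x))
    (by fun_prop))).congr (Filter.Eventually.of_forall fun x => ?_)
  simp [mul_assoc, ← Real.exp_add]

theorem measurable_Gamma : Measurable Real.Gamma := by
  have h : Measurable fun x : ℝ => ((Complex.Gamma x)⁻¹)⁻¹.re :=
    Complex.measurable_re.comp (Complex.differentiable_one_div_Gamma.continuous.measurable.comp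
      Complex.measurable_ofReal).inv
  simp only [inv_inv, Complex.Gamma_ofReal, Complex.ofReal_re] at h
  exact h

theorem norm_mul_rpow_div_Gamma_le (w : ℝ → ℝ) {b t t₀ T x : ℝ} (r : ℝ) (hb : -1 < b)
    (hx : 0 < x) (ht₀ : 0 < t₀) (ht : t₀ ≤ t) (htT : t ≤ T) :
    ‖w x * (t ^ (x + b) / Real.Gamma (x + b + 1))‖ ≤ ‖w x * Real.exp (-r * x)‖ *
      (Real.exp (-r * (b + 1)) * (Real.exp (T * Real.exp (r + 1)) / t₀)) := by
  have h := rpow_div_Gamma_le' r (by linarith : -1 < x + b) ht₀ ht htT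
  have hΓ : 0 < Real.Gamma (x + b + 1) := Real.Gamma_pos_of_pos (by linarith)
  have htp : 0 < t := ht₀.trans_le ht
  rw [norm_mul, norm_mul, Real.norm_of_nonneg (Real.exp_pos _).le, mul_assoc,
    Real.norm_of_nonneg (by positivity : 0 ≤ t ^ (x + b) / Real.Gamma (x + b + 1))]
  refine mul_le_mul_of_nonneg_left (h.trans_eq ?_) (norm_nonneg _)
  rw [← mul_assoc, ← Real.exp_add]
  ring_nf

theorem ExpWeight.integrable_volterra {w : ℝ → ℝ} (hw : ExpWeight w) {b t : ℝ} (hb : -1 < b)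
    (ht : 0 < t) :
    IntegrableOn (fun x => w x * (t ^ (x + b) / Real.Gamma (x + b + 1))) (Ioi 0) := by
  obtain ⟨r, hr⟩ := id hw
  refine (hr.norm.mul_const (Real.exp (-r * (b + 1)) * (Real.exp (t * Real.exp (r + 1)) / t))).mono'
    (hw.aestronglyMeasurable.mul ?_) ?_
  rotate_left
  · filter_upwards [ae_restrict_mem measurableSet_Ioi] with x hx
    exact norm_mul_rpow_div_Gamma_le w r hb hx ht le_rfl le_rfl
  · exact (((measurable_const.pow (by fun_prop)).div
      (measurable_Gamma.comp (by fun_prop))).aestronglyMeasurable)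

theorem ExpWeight.continuousOn_weightedVolterra {w : ℝ → ℝ} (hw : ExpWeight w) {b : ℝ}
    (hb : -1 < b) : ContinuousOn (weightedVolterra w b) (Ioi 0) := by
  intro t ht
  have ht : 0 < t := ht
  obtain ⟨r, hr⟩ := id hw
  have hs : Ioo (t / 2) (2 * t) ∈ nhds t := Ioo_mem_nhds (by linarith) (by linarith)
  refine (continuousAt_of_dominated ?_ ?_ (hr.norm.mul_const
    (Real.exp (-r * (b + 1)) * (Real.exp (2 * t * Real.exp (r + 1)) / (t / 2)))) ?_
    ).continuousWithinAt
  · filter_upwards [lt_mem_nhds ht] with y hy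
    exact (hw.integrable_volterra hb hy).aestronglyMeasurable
  · filter_upwards [hs] with y hy
    filter_upwards [ae_restrict_mem measurableSet_Ioi] with x hx
    exact norm_mul_rpow_div_Gamma_le w r hb hx (half_pos ht) hy.1.le hy.2.le
  · exact Filter.Eventually.of_forall fun x => continuousAt_const.mul
      ((Real.continuousAt_rpow_const _ _ (Or.inl ht.ne')).div_const _)

/-- The normalization by Gamma makes differentiation a shift of the index by one; on `(t/2, 2t)` the
differentiated integrand has an integrable majorant. -/
theorem ExpWeight.hasDerivAt_weightedVolterra {w : ℝ → ℝ} (hw : ExpWeight w) {b t : ℝ}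
    (hb : -1 < b) (ht : 0 < t) :
    HasDerivAt (weightedVolterra w (b + 1)) (weightedVolterra w b t) t := by
  obtain ⟨r, hr⟩ := id hw
  have hs : Ioo (t / 2) (2 * t) ∈ nhds t := Ioo_mem_nhds (by linarith) (by linarith)
  refine (hasDerivAt_integral_of_dominated_loc_of_deriv_le (s := Ioo (t / 2) (2 * t))
    (bound := fun x => ‖w x * Real.exp (-r * x)‖ *
      (Real.exp (-r * (b + 1)) * (Real.exp (2 * t * Real.exp (r + 1)) / (t / 2))))
    (F := fun t x => w x * (t ^ (x + (b + 1)) / Real.Gamma (x + (b + 1) + 1)))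
    (F' := fun t x => w x * (t ^ (x + b) / Real.Gamma (x + b + 1))) hs ?_
    (hw.integrable_volterra (by linarith) ht)
    (hw.integrable_volterra hb ht).aestronglyMeasurable ?_ (hr.norm.mul_const _) ?_).2
  · filter_upwards [lt_mem_nhds ht] with y hy
    exact (hw.integrable_volterra (by linarith) hy).aestronglyMeasurable
  · filter_upwards [ae_restrict_mem measurableSet_Ioi] with x hx y hy
    exact norm_mul_rpow_div_Gamma_le w r hb hx (half_pos ht) hy.1.le hy.2.le
  · filter_upwards [ae_restrict_mem measurableSet_Ioi] with x hx y hy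
    have hx : (0 : ℝ) < x := hx
    have hy0 : 0 < y := by linarith [hy.1]
    have hne : x + b + 1 ≠ 0 := by linarith
    have hΓ : Real.Gamma (x + b + 1) ≠ 0 := (Real.Gamma_pos_of_pos (by linarith)).ne'
    have h := (((Real.hasDerivAt_rpow_const (p := x + b + 1) (Or.inl hy0.ne')).div_const
      (Real.Gamma (x + b + 1 + 1))).const_mul (w x))
    simp only [add_sub_cancel_right] at h
    rw [← add_assoc x b 1]
    refine h.congr_deriv ?_
    rw [Real.Gamma_add_one hne]
    field_simp

theorem ExpWeight.contDiffOn_weightedVolterra {w : ℝ → ℝ} (hw : ExpWeight w) {b : ℝ}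
    (hb : -1 < b) (n : ℕ) : ContDiffOn ℝ n (weightedVolterra w (b + n)) (Ioi 0) := by
  induction n with
  | zero => simpa using hw.continuousOn_weightedVolterra hb
  | succ n ih =>
    have hbn : -1 < b + n := lt_add_of_lt_of_nonneg hb n.cast_nonneg
    have hd : ∀ t ∈ Ioi (0 : ℝ), HasDerivAt (weightedVolterra w (b + (n + 1 : ℕ)))
        (weightedVolterra w (b + n) t) t := fun t ht => by
      rw [Nat.cast_succ, ← add_assoc]
      exact hw.hasDerivAt_weightedVolterra hbn ht
    rw [Nat.cast_succ (R := WithTop ℕ∞), contDiffOn_succ_iff_deriv_of_isOpen isOpen_Ioi]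
    exact ⟨fun t ht => (hd t ht).differentiableAt.differentiableWithinAt, by simp,
      ih.congr fun t ht => (hd t ht).deriv⟩

theorem ExpWeight.iteratedDeriv_weightedVolterra {w : ℝ → ℝ} (hw : ExpWeight w) {b : ℝ}
    (hb : -1 < b) (n : ℕ) {t : ℝ} (ht : 0 < t) :
    iteratedDeriv n (weightedVolterra w (b + n)) t = weightedVolterra w b t := by
  induction n with
  | zero => simp
  | succ n ih =>
    have hbn : -1 < b + n := lt_add_of_lt_of_nonneg hb n.cast_nonneg
    rw [iteratedDeriv_succ', ← ih]
    refine Filter.EventuallyEq.iteratedDeriv_eq _ ?_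
    filter_upwards [lt_mem_nhds ht] with y hy
    rw [Nat.cast_succ, ← add_assoc]
    exact (hw.hasDerivAt_weightedVolterra hbn hy).deriv

/-! ### Fractional integration and differentiation as a shift of the index. -/

theorem integral_powerKernel_mul_rpow {A z t : ℝ} (hA : 0 < A) (hz : -1 < z) (ht : 0 < t) :
    ∫ τ in (0 : ℝ)..t, powerKernel A (t - τ) * (τ ^ z / Real.Gamma (z + 1)) =
      t ^ (z + A) / Real.Gamma (z + A + 1) := by
  have h := Complex.betaIntegral_scaled (z + 1 : ℝ) (A : ℝ) ht
  have hG := Complex.Gamma_mul_Gamma_eq_betaIntegral (s := (z + 1 : ℝ)) (t := (A : ℝ))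
    (by simpa using by linarith) (by simpa using hA)
  have hreal : ((∫ τ in (0 : ℝ)..t, τ ^ z * (t - τ) ^ (A - 1) : ℝ) : ℂ) =
      ∫ τ in (0 : ℝ)..t, (τ : ℂ) ^ (((z + 1 : ℝ) : ℂ) - 1) * ((t : ℂ) - τ) ^ ((A : ℂ) - 1) := by
    rw [← intervalIntegral.integral_ofReal]
    refine intervalIntegral.integral_congr fun τ hτ => ?_
    rw [uIcc_of_le ht.le] at hτ
    rw [Complex.ofReal_mul, Complex.ofReal_cpow hτ.1, Complex.ofReal_cpow (sub_nonneg.2 hτ.2)]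
    push_cast
    ring_nf
  have hΓA := (Real.Gamma_pos_of_pos hA).ne'
  have hΓz := (Real.Gamma_pos_of_pos (by linarith : 0 < z + 1)).ne'
  have hΓs := (Real.Gamma_pos_of_pos (by linarith : 0 < z + A + 1)).ne'
  have key : ∫ τ in (0 : ℝ)..t, τ ^ z * (t - τ) ^ (A - 1) =
      t ^ (z + A) * (Real.Gamma (z + 1) * Real.Gamma A / Real.Gamma (z + A + 1)) := by
    rw [← Complex.ofReal_inj, hreal, h]
    have hne : Complex.Gamma ((z + 1 : ℝ) + (A : ℝ)) ≠ 0 := by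
      rw [← Complex.ofReal_add, Complex.Gamma_ofReal, Complex.ofReal_ne_zero]
      convert hΓs using 2; ring
    rw [eq_div_of_mul_eq hne ((mul_comm _ _).trans hG.symm), ← Complex.ofReal_add,
      Complex.Gamma_ofReal, Complex.Gamma_ofReal, Complex.Gamma_ofReal]
    push_cast [Complex.ofReal_cpow ht.le]
    ring_nf
  calc _ = ∫ τ in (0 : ℝ)..t, (Real.Gamma A * Real.Gamma (z + 1))⁻¹ *
        (τ ^ z * (t - τ) ^ (A - 1)) := by
        refine intervalIntegral.integral_congr fun τ _ => ?_
        simp only [powerKernel]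
        field_simp
    _ = _ := by
        rw [intervalIntegral.integral_const_mul, key]
        field_simp

theorem intervalIntegrable_powerKernel {A : ℝ} (hA : 0 < A) (t : ℝ) :
    IntervalIntegrable (fun τ => powerKernel A (t - τ)) volume 0 t := by
  have h : IntervalIntegrable (fun x : ℝ => x ^ (A - 1)) volume 0 t :=
    intervalIntegral.intervalIntegrable_rpow' (by linarith)
  simpa [powerKernel] using (h.div_const (Real.Gamma A)).comp_sub_left t |>.symm

theorem measurable_powerKernel (A : ℝ) : Measurable (powerKernel A) := by
  unfold powerKernel
  fun_prop

theorem measurable_rpow_div_Gamma (b : ℝ) :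
    Measurable fun p : ℝ × ℝ => p.1 ^ (p.2 + b) / Real.Gamma (p.2 + b + 1) :=
  (measurable_fst.pow (by fun_prop)).div (measurable_Gamma.comp (by fun_prop))

/-- Joint integrability of `g(u) w(x) u^(x+b) / Γ(x+b+1)` when `g` decays exponentially. -/
theorem ExpWeight.integrable_prod {w : ℝ → ℝ} (hw : ExpWeight w) {b : ℝ} (hb : 0 ≤ b) :
    ∃ B : ℝ, ∀ (g : ℝ → ℂ) (S : Set ℝ), MeasurableSet S → S ⊆ Ioi 0 →
      AEStronglyMeasurable g (volume.restrict S) →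
      IntegrableOn (fun u => ‖g u‖ * Real.exp (B * u)) S →
      Integrable (fun p : ℝ × ℝ => g p.1 *
        ((w p.2 * (p.1 ^ (p.2 + b) / Real.Gamma (p.2 + b + 1)) : ℝ) : ℂ))
        ((volume.restrict S).prod (volume.restrict (Ioi 0))) := by
  obtain ⟨r, hr⟩ := id hw
  -- The rate depends on the weight alone, so `g` can be chosen afterwards to decay faster than `exp
  -- (-B * u)`.
  refine ⟨Real.exp r, fun g S hS hS0 hgm hg => ?_⟩
  refine ((hg.mul_prod hr.norm).mul_const (Real.exp (-r * b))).mono' ?_ ?_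
  · have h1 : AEStronglyMeasurable (fun p : ℝ × ℝ => w p.2 *
        (p.1 ^ (p.2 + b) / Real.Gamma (p.2 + b + 1)))
        ((volume.restrict S).prod (volume.restrict (Ioi 0))) :=
      hw.aestronglyMeasurable.comp_snd.mul (measurable_rpow_div_Gamma b).aestronglyMeasurable
    exact hgm.comp_fst.mul (Complex.continuous_ofReal.comp_aestronglyMeasurable h1)
  · rw [Measure.prod_restrict]
    filter_upwards [ae_restrict_mem (hS.prod measurableSet_Ioi)] with p hp
    have hu : 0 < p.1 := hS0 hp.1
    have hx : 0 < p.2 := hp.2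
    have h := rpow_div_Gamma_le r (by linarith : 0 ≤ p.2 + b) hu le_rfl
    have hΓ : 0 < Real.Gamma (p.2 + b + 1) := Real.Gamma_pos_of_pos (by linarith)
    rw [norm_mul, Complex.norm_real, norm_mul, norm_mul, Real.norm_of_nonneg
      (by positivity : 0 ≤ p.1 ^ (p.2 + b) / Real.Gamma (p.2 + b + 1)),
      Real.norm_of_nonneg (Real.exp_pos _).le]
    calc _ ≤ ‖g p.1‖ * (‖w p.2‖ * (Real.exp (-r * (p.2 + b)) *
          Real.exp (p.1 * Real.exp r))) := by gcongr
      _ = _ := by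
        rw [mul_add, Real.exp_add, mul_comm p.1]
        ring

theorem ExpWeight.laplaceConv_powerKernel {w : ℝ → ℝ} (hw : ExpWeight w) {A α t : ℝ} (hA : 0 < A)
    (hα : 0 ≤ α) (ht : 0 < t) :
    IntervalIntegrable (fun τ => powerKernel A (t - τ) * weightedVolterra w α τ) volume 0 t ∧
      laplaceConv (powerKernel A) (weightedVolterra w α) t = weightedVolterra w (α + A) t := by
  obtain ⟨B, hB⟩ := hw.integrable_prod hα
  have hk := (intervalIntegrable_powerKernel hA t).1
  have hint := hB (fun τ => (powerKernel A (t - τ) : ℂ)) (Ioc 0 t) measurableSet_Ioc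
    (fun _ h => h.1) (by exact (Complex.measurable_ofReal.comp ((measurable_powerKernel A).comp
      (by fun_prop))).aestronglyMeasurable)
    (by
      simp only [Complex.norm_real]
      refine Integrable.mul_bdd (c := Real.exp (|B| * t)) hk.norm (by fun_prop) ?_
      filter_upwards [ae_restrict_mem measurableSet_Ioc] with τ hτ
      rw [Real.norm_of_nonneg (Real.exp_pos _).le]
      have := le_abs_self B
      have := hτ.1
      have := hτ.2
      gcongr)
  have hint' : Integrable (fun p : ℝ × ℝ => powerKernel A (t - p.1) *
      (w p.2 * (p.1 ^ (p.2 + α) / Real.Gamma (p.2 + α + 1))))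
      ((volume.restrict (Ioc 0 t)).prod (volume.restrict (Ioi 0))) := by
    convert hint.re using 2 with p
    rw [← Complex.ofReal_mul]
    rfl
  have hV : ∀ τ, ∫ x in Ioi (0 : ℝ), powerKernel A (t - τ) *
      (w x * (τ ^ (x + α) / Real.Gamma (x + α + 1))) =
      powerKernel A (t - τ) * weightedVolterra w α τ := fun τ => integral_const_mul _ _
  refine ⟨?_, ?_⟩
  · rw [intervalIntegrable_iff_integrableOn_Ioc_of_le ht.le]
    have := hint'.integral_prod_left
    simp only [hV] at this
    exact this
  · rw [laplaceConv, intervalIntegral.integral_of_le ht.le]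
    simp only [← hV]
    rw [integral_integral_swap hint', weightedVolterra]
    refine setIntegral_congr_fun measurableSet_Ioi fun x hx => ?_
    have hx : (0 : ℝ) < x := hx
    have := integral_powerKernel_mul_rpow hA (by linarith : -1 < x + α) ht
    rw [intervalIntegral.integral_of_le ht.le] at this
    simp only [mul_left_comm _ (w x)]
    rw [integral_const_mul, this, ← add_assoc]

theorem ExpWeight.powerConvExists {w : ℝ → ℝ} (hw : ExpWeight w) {a α : ℝ} (hα : 0 ≤ α)
    (haα : 0 < α + a + 1) : PowerConvExists a (weightedVolterra w α) := by
  refine ⟨fun t ht => (hw.laplaceConv_powerKernel (regOrder_pos a) hα ht).1, ?_⟩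
  refine (hw.contDiffOn_weightedVolterra (b := α + a) (by linarith) (regOrder a)).congr
    fun t ht => ?_
  rw [(hw.laplaceConv_powerKernel (regOrder_pos a) hα ht).2, add_assoc]

theorem ExpWeight.powerConv_weightedVolterra {w : ℝ → ℝ} (hw : ExpWeight w) {a α t : ℝ}
    (hα : 0 ≤ α) (haα : 0 < α + a + 1) (ht : 0 < t) :
    powerConv a (weightedVolterra w α) t = weightedVolterra w (α + a) t := by
  rw [powerConv, ← hw.iteratedDeriv_weightedVolterra (by linarith) (regOrder a) ht]
  refine Filter.EventuallyEq.iteratedDeriv_eq _ ?_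
  filter_upwards [lt_mem_nhds ht] with y hy
  rw [(hw.laplaceConv_powerKernel (regOrder_pos a) hα hy).2, add_assoc]

/-! ### The inversion kernel on vertical lines. -/

/-- The integrand `e^(st) e^(-u s^ν) / s^m` of the inversion integral. -/
def expKernel (ν m t u : ℝ) (s : ℂ) : ℂ :=
  Complex.exp (s * t) * (Complex.exp (-((u : ℂ) * s ^ (ν : ℂ))) / s ^ (m : ℂ))

theorem expInv_eq (ν m c t u : ℝ) :
    expInv ν m c t u =
      (1 / (2 * (Real.pi : ℂ))) * ∫ y : ℝ, expKernel ν m t u ((c : ℂ) + (y : ℂ) * Complex.I) := by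
  rw [expInv, bromwich, integral_mul_const]
  unfold expKernel
  rw [← mul_assoc, mul_right_comm]
  congr 1
  have := Complex.I_ne_zero
  field_simp

theorem re_line (c y : ℝ) : ((c : ℂ) + (y : ℂ) * Complex.I).re = c := by simp

theorem norm_line (c y : ℝ) : ‖(c : ℂ) + (y : ℂ) * Complex.I‖ = (c ^ 2 + y ^ 2) ^ (1 / 2 : ℝ) := by
  rw [Complex.norm_add_mul_I, Real.sqrt_eq_rpow]

theorem norm_pos_of_re_pos {s : ℂ} (hs : 0 < s.re) : 0 < ‖s‖ :=
  hs.trans_le (Complex.re_le_norm s)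

theorem mem_slitPlane_of_re_pos {s : ℂ} (hs : 0 < s.re) : s ∈ Complex.slitPlane :=
  Or.inl hs

theorem cos_half_pos {ν : ℝ} (hν₀ : 0 < ν) (hν₁ : ν < 1) : 0 < Real.cos (Real.pi / 2 * ν) := by
  have := Real.pi_pos
  apply Real.cos_pos_of_mem_Ioo
  constructor <;> nlinarith

/-- In the right half-plane `s ^ ν` has argument at most `πν/2 < π/2` in absolute value, so its real
part controls its modulus. -/
theorem cos_mul_norm_rpow_le_re_cpow {ν : ℝ} (hν₀ : 0 < ν) (hν₁ : ν < 1) {s : ℂ} (hs : 0 < s.re) :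
    Real.cos (Real.pi / 2 * ν) * ‖s‖ ^ ν ≤ (s ^ (ν : ℂ)).re := by
  rw [Complex.cpow_ofReal_re, mul_comm]
  refine mul_le_mul_of_nonneg_left ?_ (by positivity)
  have h : |s.arg| ≤ Real.pi / 2 := Complex.abs_arg_le_pi_div_two_iff.2 hs.le
  have hpi := Real.pi_pos
  rw [← Real.cos_abs (s.arg * ν), abs_mul, abs_of_pos hν₀]
  apply Real.cos_le_cos_of_nonneg_of_le_pi
  · positivity
  · nlinarith
  · gcongr

theorem exp_neg_le_rpow {δ x : ℝ} (hδ : 0 ≤ δ) (hx : 0 < x) :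
    Real.exp (-x) ≤ δ ^ δ * x ^ (-δ) := by
  rcases hδ.eq_or_lt with rfl | hδ
  · simp [hx.le]
  · have h1 : x / δ ≤ Real.exp (x / δ) := (by linarith [Real.add_one_le_exp (x / δ)])
    have h2 : (x / δ) ^ δ ≤ Real.exp x := by
      calc (x / δ) ^ δ ≤ Real.exp (x / δ) ^ δ := by gcongr
        _ = Real.exp x := by rw [← Real.exp_mul, div_mul_cancel₀ _ hδ.ne']
    rw [Real.div_rpow hx.le hδ.le, div_le_iff₀ (by positivity)] at h2
    rw [Real.exp_neg, Real.rpow_neg hx.le, ← div_eq_mul_inv, le_div_iff₀ (by positivity),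
      inv_mul_le_iff₀ (Real.exp_pos _)]
    exact h2

theorem norm_expKernel (ν m t u : ℝ) (s : ℂ) :
    ‖expKernel ν m t u s‖ =
      Real.exp (s.re * t) * Real.exp (-(u * (s ^ (ν : ℂ)).re)) * ‖s‖ ^ (-m) := by
  rw [expKernel, norm_mul, norm_div, Complex.norm_exp, Complex.norm_exp, Complex.norm_cpow_real,
    Real.rpow_neg (norm_nonneg _), mul_assoc, div_eq_mul_inv]
  simp

/-- The exponential decay is split in two halves: one, bounded through `s.re`, keeps decay in `u`;
the other is traded for the power `‖s‖ ^ (-(ν * δ))`, which gives integrability along the line at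
the price of `u ^ (-δ)`. -/
theorem norm_expKernel_le {ν : ℝ} (hν₀ : 0 < ν) (hν₁ : ν < 1) {m t u δ : ℝ} (hu : 0 < u)
    (hδ : 0 ≤ δ) {s : ℂ} (hs : 0 < s.re) :
    ‖expKernel ν m t u s‖ ≤ Real.exp (s.re * t) *
      Real.exp (-(u * (Real.cos (Real.pi / 2 * ν) / 2 * s.re ^ ν))) *
      (δ ^ δ * (Real.cos (Real.pi / 2 * ν) / 2) ^ (-δ) * u ^ (-δ)) * ‖s‖ ^ (-(m + ν * δ)) := by
  have hk := cos_half_pos hν₀ hν₁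
  have hre := cos_mul_norm_rpow_le_re_cpow hν₀ hν₁ hs
  set k := Real.cos (Real.pi / 2 * ν)
  have hn := norm_pos_of_re_pos hs
  rw [norm_expKernel]
  have h1 : Real.exp (-(u * (s ^ (ν : ℂ)).re)) ≤
      Real.exp (-(u * (k / 2 * s.re ^ ν))) * Real.exp (-(k / 2 * u * ‖s‖ ^ ν)) := by
    rw [← Real.exp_add, Real.exp_le_exp]
    have : s.re ^ ν ≤ ‖s‖ ^ ν := by
      gcongr
      exact Complex.re_le_norm s
    nlinarith [mul_le_mul_of_nonneg_left hre hu.le, mul_le_mul_of_nonneg_left this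
      (by positivity : 0 ≤ u * k)]
  have h2 := exp_neg_le_rpow hδ (by positivity : 0 < k / 2 * u * ‖s‖ ^ ν)
  rw [Real.mul_rpow (by positivity) (by positivity), Real.mul_rpow (by positivity) (by positivity),
    ← Real.rpow_mul hn.le] at h2
  calc _ ≤ Real.exp (s.re * t) * (Real.exp (-(u * (k / 2 * s.re ^ ν))) *
        (δ ^ δ * ((k / 2) ^ (-δ) * u ^ (-δ) * ‖s‖ ^ (ν * -δ)))) * ‖s‖ ^ (-m) := by
        have := h1.trans (mul_le_mul_of_nonneg_left h2 (Real.exp_pos _).le)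
        gcongr
    _ = _ := by
        rw [neg_add, Real.rpow_add hn, mul_neg]
        ring

theorem integrable_norm_line_rpow {c q : ℝ} (hc : 0 < c) (hq : 1 < q) :
    Integrable fun y : ℝ => ‖(c : ℂ) + (y : ℂ) * Complex.I‖ ^ (-q) := by
  have h := (integrable_rpow_neg_one_add_norm_sq (E := ℝ) (μ := volume) (r := q)
    (by simpa using hq)).comp_div hc.ne' |>.const_mul (c ^ (-q))
  refine h.congr (Filter.Eventually.of_forall fun y => ?_)
  have : c ^ 2 + y ^ 2 = c ^ 2 * (1 + ‖y / c‖ ^ 2) := by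
    rw [Real.norm_eq_abs, sq_abs]; field_simp
  simp only
  rw [norm_line, this, ← Real.rpow_mul (by positivity), Real.mul_rpow (by positivity) (by positivity),
    ← Real.rpow_natCast c, ← Real.rpow_mul hc.le]
  congr 2 <;> push_cast <;> ring

theorem norm_line_rpow_le {c₀ c q : ℝ} (hc₀ : 0 < c₀) (hc : c₀ ≤ c) (hq : 0 ≤ q) (y : ℝ) :
    ‖(c : ℂ) + (y : ℂ) * Complex.I‖ ^ (-q) ≤ ‖(c₀ : ℂ) + (y : ℂ) * Complex.I‖ ^ (-q) := by
  apply Real.rpow_le_rpow_of_nonpos (norm_pos_of_re_pos (by simpa using hc₀)) _ (by linarith)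
  rw [norm_line, norm_line]
  gcongr

theorem measurable_expKernel_line (ν m t u c : ℝ) :
    Measurable fun y : ℝ => expKernel ν m t u ((c : ℂ) + (y : ℂ) * Complex.I) := by
  unfold expKernel
  fun_prop

theorem exists_rpow_exponent {ν : ℝ} (hν₀ : 0 < ν) (m : ℝ) : ∃ δ : ℝ, 0 ≤ δ ∧ 1 < m + ν * δ := by
  refine ⟨(2 + |m|) / ν, by positivity, ?_⟩
  rw [mul_div_cancel₀ _ hν₀.ne']
  linarith [neg_abs_le m]

/-- Domination of the integrand, uniformly over a strip of vertical lines. -/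
theorem exists_bound_expKernel {ν : ℝ} (hν₀ : 0 < ν) (hν₁ : ν < 1) (m t : ℝ) {u c₀ c₁ : ℝ}
    (hu : 0 < u) (hc₀ : 0 < c₀) : ∃ bound : ℝ → ℝ, Integrable bound ∧
      ∀ c ∈ Icc c₀ c₁, ∀ y : ℝ,
        ‖expKernel ν m t u ((c : ℂ) + (y : ℂ) * Complex.I)‖ ≤ bound y := by
  obtain ⟨δ, hδ, hq⟩ := exists_rpow_exponent hν₀ m
  have hk := cos_half_pos hν₀ hν₁
  refine ⟨_, (integrable_norm_line_rpow hc₀ hq).const_mul (Real.exp (c₁ * |t|) *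
    (δ ^ δ * (Real.cos (Real.pi / 2 * ν) / 2) ^ (-δ) * u ^ (-δ))), fun c hc y => ?_⟩
  have hc' : 0 < c := hc₀.trans_le hc.1
  refine (norm_expKernel_le hν₀ hν₁ hu hδ (by simpa using hc')).trans ?_
  rw [re_line]
  have h1 : Real.exp (c * t) * Real.exp (-(u * (Real.cos (Real.pi / 2 * ν) / 2 * c ^ ν))) ≤
      Real.exp (c₁ * |t|) := by
    rw [← Real.exp_add, Real.exp_le_exp]
    have h2 : 0 ≤ u * (Real.cos (Real.pi / 2 * ν) / 2 * c ^ ν) := by positivity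
    have h3 : c * t ≤ c * |t| := by gcongr; exact le_abs_self t
    have h4 : c * |t| ≤ c₁ * |t| := by gcongr; exact hc.2
    linarith
  have h5 := norm_line_rpow_le hc₀ hc.1 (by linarith : 0 ≤ m + ν * δ) y
  gcongr

theorem integrable_expKernel {ν : ℝ} (hν₀ : 0 < ν) (hν₁ : ν < 1) (m t : ℝ) {u c : ℝ}
    (hu : 0 < u) (hc : 0 < c) :
    Integrable fun y : ℝ => expKernel ν m t u ((c : ℂ) + (y : ℂ) * Complex.I) := by
  obtain ⟨b, hb, hle⟩ := exists_bound_expKernel hν₀ hν₁ m t (c₁ := c) hu hc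
  exact hb.mono' (measurable_expKernel_line ν m t u c).aestronglyMeasurable
    (Filter.Eventually.of_forall fun y => hle c ⟨le_rfl, le_rfl⟩ y)

/-! ### Differentiating the kernel: recurrence, change of line, decay in `u`. -/

theorem hasDerivAt_expKernel (ν m t u : ℝ) {s : ℂ} (hs : 0 < s.re) :
    HasDerivAt (expKernel ν m t u)
      (t * expKernel ν m t u s - u * ν * expKernel ν (m + 1 - ν) t u s -
        m * expKernel ν (m + 1) t u s) s := by
  have hsl := mem_slitPlane_of_re_pos hs
  have hs0 : s ≠ 0 := Complex.slitPlane_ne_zero hsl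
  have h1 : HasDerivAt (fun s : ℂ => Complex.exp (s * t)) (Complex.exp (s * t) * t) s := by
    simpa using ((hasDerivAt_id s).mul_const (t : ℂ)).cexp
  have hp : ∀ p : ℂ, HasDerivAt (fun s : ℂ => s ^ p) (p * s ^ (p - 1)) s := fun p => by
    simpa using (hasDerivAt_id s).cpow_const (c := p) hsl
  have h2 := ((hp ν).const_mul (u : ℂ)).neg.cexp
  have hm : s ^ (m : ℂ) ≠ 0 := by simp [Complex.cpow_eq_zero_iff, hs0]
  refine (h1.mul (h2.div (hp m) hm)).congr_deriv ?_
  simp only [expKernel, Pi.div_apply, Pi.neg_apply]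
  push_cast
  have e1 : s ^ ((m : ℂ) + 1 - ν) = s ^ (m : ℂ) * s / s ^ (ν : ℂ) := by
    rw [Complex.cpow_sub _ _ hs0, Complex.cpow_add _ _ hs0, Complex.cpow_one]
  have e2 : s ^ ((m : ℂ) + 1) = s ^ (m : ℂ) * s := by
    rw [Complex.cpow_add _ _ hs0, Complex.cpow_one]
  have hν : s ^ (ν : ℂ) ≠ 0 := by simp [Complex.cpow_eq_zero_iff, hs0]
  rw [e1, e2, Complex.cpow_sub _ _ hs0, Complex.cpow_sub _ _ hs0, Complex.cpow_one]
  field_simp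
  ring

theorem hasDerivAt_expKernel_vertical (ν m t u : ℝ) {c : ℝ} (hc : 0 < c) (y : ℝ) :
    HasDerivAt (fun y : ℝ => expKernel ν m t u ((c : ℂ) + (y : ℂ) * Complex.I))
      ((t * expKernel ν m t u ((c : ℂ) + (y : ℂ) * Complex.I) -
        u * ν * expKernel ν (m + 1 - ν) t u ((c : ℂ) + (y : ℂ) * Complex.I) -
        m * expKernel ν (m + 1) t u ((c : ℂ) + (y : ℂ) * Complex.I)) * Complex.I) y := by
  have h := hasDerivAt_expKernel ν m t u (s := (c : ℂ) + (y : ℂ) * Complex.I) (by simpa using hc)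
  have h2 : HasDerivAt (fun y : ℝ => (c : ℂ) + (y : ℂ) * Complex.I) Complex.I y := by
    simpa using ((Complex.ofRealCLM.hasDerivAt (x := y)).mul_const Complex.I).const_add (c : ℂ)
  exact HasDerivAt.comp y h h2

theorem hasDerivAt_expKernel_horizontal (ν m t u : ℝ) {c : ℝ} (hc : 0 < c) (y : ℝ) :
    HasDerivAt (fun c : ℝ => expKernel ν m t u ((c : ℂ) + (y : ℂ) * Complex.I))
      (t * expKernel ν m t u ((c : ℂ) + (y : ℂ) * Complex.I) -
        u * ν * expKernel ν (m + 1 - ν) t u ((c : ℂ) + (y : ℂ) * Complex.I) -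
        m * expKernel ν (m + 1) t u ((c : ℂ) + (y : ℂ) * Complex.I)) c := by
  have h := hasDerivAt_expKernel ν m t u (s := (c : ℂ) + (y : ℂ) * Complex.I) (by simpa using hc)
  have h2 : HasDerivAt (fun c : ℝ => (c : ℂ) + (y : ℂ) * Complex.I) 1 c := by
    simpa using (Complex.ofRealCLM.hasDerivAt (x := c)).add_const ((y : ℂ) * Complex.I)
  have h3 := HasDerivAt.comp c h h2
  rw [mul_one] at h3
  exact h3

/-- A derivative along the line integrates to zero, since the kernel and its derivative are
integrable. This replaces contour arguments: it gives both the recurrence in `m` and the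
independence of `c`. -/
theorem integral_deriv_expKernel {ν : ℝ} (hν₀ : 0 < ν) (hν₁ : ν < 1)
    (m t : ℝ) {u c : ℝ} (hu : 0 < u) (hc : 0 < c) :
    ∫ y : ℝ, (t * expKernel ν m t u ((c : ℂ) + (y : ℂ) * Complex.I) -
        u * ν * expKernel ν (m + 1 - ν) t u ((c : ℂ) + (y : ℂ) * Complex.I) -
        m * expKernel ν (m + 1) t u ((c : ℂ) + (y : ℂ) * Complex.I)) = 0 := by
  have h := integral_eq_zero_of_hasDerivAt_of_integrable
    (fun y => hasDerivAt_expKernel_vertical ν m t u hc y)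
    (((((integrable_expKernel hν₀ hν₁ m t hu hc).const_mul _).sub
      ((integrable_expKernel hν₀ hν₁ _ t hu hc).const_mul _)).sub
      ((integrable_expKernel hν₀ hν₁ _ t hu hc).const_mul _)).mul_const _)
    (integrable_expKernel hν₀ hν₁ m t hu hc)
  rw [integral_mul_const] at h
  simpa using h

theorem mul_expInv {ν : ℝ} (hν₀ : 0 < ν) (hν₁ : ν < 1)
    (m t : ℝ) {u c : ℝ} (hu : 0 < u) (hc : 0 < c) :
    t * expInv ν m c t u =
      u * ν * expInv ν (m + 1 - ν) c t u + m * expInv ν (m + 1) c t u := by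
  have h := integral_deriv_expKernel hν₀ hν₁ m t hu hc
  have i := fun m => integrable_expKernel hν₀ hν₁ m t hu hc
  have j : Integrable fun y : ℝ => t * expKernel ν m t u ((c : ℂ) + (y : ℂ) * Complex.I) -
      u * ν * expKernel ν (m + 1 - ν) t u ((c : ℂ) + (y : ℂ) * Complex.I) :=
    ((i _).const_mul _).sub ((i _).const_mul _)
  rw [integral_sub j ((i _).const_mul _),
    integral_sub ((i _).const_mul _) ((i _).const_mul _), integral_const_mul, integral_const_mul,
    integral_const_mul] at h
  simp only [expInv_eq]
  linear_combination (1 / (2 * (Real.pi : ℂ))) * h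

/-- The inversion integral does not depend on the line of integration. -/
theorem expInv_eq_expInv {ν : ℝ} (hν₀ : 0 < ν) (hν₁ : ν < 1)
    (m t : ℝ) {u c c' : ℝ} (hu : 0 < u) (hc : 0 < c) (hc' : 0 < c') :
    expInv ν m c t u = expInv ν m c' t u := by
  have hd : ∀ c ∈ Ioi (0 : ℝ), HasDerivAt
      (fun c : ℝ => ∫ y : ℝ, expKernel ν m t u ((c : ℂ) + (y : ℂ) * Complex.I)) 0 c := by
    intro c hc
    have hc : 0 < c := hc
    obtain ⟨b₁, hb₁, h₁⟩ := exists_bound_expKernel hν₀ hν₁ m t (c₁ := 2 * c) hu (half_pos hc)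
    obtain ⟨b₂, hb₂, h₂⟩ :=
      exists_bound_expKernel hν₀ hν₁ (m + 1 - ν) t (c₁ := 2 * c) hu (half_pos hc)
    obtain ⟨b₃, hb₃, h₃⟩ :=
      exists_bound_expKernel hν₀ hν₁ (m + 1) t (c₁ := 2 * c) hu (half_pos hc)
    have i := fun m => integrable_expKernel hν₀ hν₁ m t hu hc
    -- The `c`-derivative of the integrand is the complex derivative of the kernel, whose integral
    -- vanishes.
    rw [← integral_deriv_expKernel hν₀ hν₁ m t hu hc]
    refine (hasDerivAt_integral_of_dominated_loc_of_deriv_le (s := Icc (c / 2) (2 * c))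
      (F' := fun c y => (t * expKernel ν m t u ((c : ℂ) + (y : ℂ) * Complex.I) -
        u * ν * expKernel ν (m + 1 - ν) t u ((c : ℂ) + (y : ℂ) * Complex.I) -
        m * expKernel ν (m + 1) t u ((c : ℂ) + (y : ℂ) * Complex.I)))
      (bound := fun y => ‖(t : ℂ)‖ * b₁ y + ‖(u * ν : ℂ)‖ * b₂ y + ‖(m : ℂ)‖ * b₃ y)
      (Icc_mem_nhds (by linarith) (by linarith)) ?_ (i m) ?_ ?_ ?_ ?_).2
    · exact Filter.Eventually.of_forall fun c =>
        (measurable_expKernel_line ν m t u c).aestronglyMeasurable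
    · exact ((((i _).const_mul _).sub ((i _).const_mul _)).sub
        ((i _).const_mul _)).aestronglyMeasurable
    · refine Filter.Eventually.of_forall fun y c' hc' => ?_
      refine (norm_sub_le _ _).trans (add_le_add ((norm_sub_le _ _).trans (add_le_add ?_ ?_)) ?_)
      all_goals rw [norm_mul]; gcongr
      exacts [h₁ c' hc' y, h₂ c' hc' y, h₃ c' hc' y]
    · exact ((hb₁.const_mul _).add (hb₂.const_mul _)).add (hb₃.const_mul _)
    · exact Filter.Eventually.of_forall fun y c' hc' =>
        hasDerivAt_expKernel_horizontal ν m t u ((half_pos hc).trans_le hc'.1) y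
  rw [expInv_eq, expInv_eq]
  congr 1
  exact isOpen_Ioi.is_const_of_deriv_eq_zero isPreconnected_Ioi
    (fun c hc => (hd c hc).differentiableAt.differentiableWithinAt) (fun c hc => (hd c hc).deriv)
    hc hc'

theorem exists_norm_expInv_le_of_one_lt {ν : ℝ} (hν₀ : 0 < ν) (hν₁ : ν < 1)
    {m δ : ℝ} (hδ : 0 ≤ δ) (hq : 1 < m + ν * δ) (t : ℝ)
    {A c : ℝ} (hA : 0 < A) (hc : 0 < c) :
    ∃ C : ℝ, ∀ u : ℝ, 0 < u → ‖expInv ν m c t u‖ ≤ C * (u ^ (-δ) * Real.exp (-(A * u))) := by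
  have hk := cos_half_pos hν₀ hν₁
  set k := Real.cos (Real.pi / 2 * ν) with hkdef
  -- On this line the retained half of the decay is exactly `exp (-(A * u))`.
  set c' := (2 * A / k) ^ (1 / ν) with hcdef
  have hc' : 0 < c' := by positivity
  have hAc : k / 2 * c' ^ ν = A := by
    rw [hcdef, ← Real.rpow_mul (by positivity), one_div_mul_cancel hν₀.ne', Real.rpow_one]
    field_simp
  have hint := integrable_norm_line_rpow hc' hq
  refine ⟨‖(1 / (2 * (Real.pi : ℂ)))‖ * (Real.exp (c' * t) * (δ ^ δ * (k / 2) ^ (-δ)) *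
    ∫ y : ℝ, ‖(c' : ℂ) + (y : ℂ) * Complex.I‖ ^ (-(m + ν * δ))), fun u hu => ?_⟩
  rw [expInv_eq_expInv hν₀ hν₁ m t hu hc hc', expInv_eq, norm_mul, mul_assoc]
  refine mul_le_mul_of_nonneg_left ?_ (norm_nonneg _)
  have h := norm_integral_le_of_norm_le (hint.const_mul (Real.exp (c' * t) *
    Real.exp (-(u * A)) * (δ ^ δ * (k / 2) ^ (-δ) * u ^ (-δ))))
    (f := fun y : ℝ => expKernel ν m t u ((c' : ℂ) + (y : ℂ) * Complex.I))
    (Filter.Eventually.of_forall fun y => by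
      have := norm_expKernel_le hν₀ hν₁ (m := m) (t := t) hu hδ
        (s := (c' : ℂ) + (y : ℂ) * Complex.I) (by simpa using hc')
      rw [re_line, ← hkdef, hAc] at this
      exact this)
  refine h.trans_eq ?_
  rw [integral_const_mul, mul_comm u A]
  ring

/-- For `μ ≤ 1 - ν`, the direct bound requires `δ ≥ 1`, not integrable at `u = 0`. Through
`mul_expInv`, the choices `δ = 3/2` (with an extra factor `u`) and `δ = 1/2` both leave `u ^
(-1/2)`. -/
theorem exists_norm_expInv_le {ν : ℝ} (hν₀ : 0 < ν) (hν₁ : ν < 1)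
    {μ : ℝ} (hμ : 0 ≤ μ) {t A c : ℝ} (ht : 0 < t) (hA : 0 < A)
    (hc : 0 < c) : ∃ C : ℝ, ∀ u : ℝ, 0 < u →
      ‖expInv ν μ c t u‖ ≤ C * (u ^ (-1 / 2 : ℝ) * Real.exp (-(A * u))) := by
  obtain ⟨C₁, h₁⟩ := exists_norm_expInv_le_of_one_lt hν₀ hν₁ (m := μ + 1 - ν) (δ := 3 / 2)
    (by norm_num) (by linarith) t hA hc
  obtain ⟨C₂, h₂⟩ := exists_norm_expInv_le_of_one_lt hν₀ hν₁ (m := μ + 1) (δ := 1 / 2)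
    (by norm_num) (by linarith) t hA hc
  refine ⟨(ν * C₁ + μ * C₂) / t, fun u hu => ?_⟩
  have h := congrArg norm (mul_expInv hν₀ hν₁ μ t hu hc)
  rw [norm_mul, Complex.norm_real, Real.norm_of_nonneg ht.le] at h
  have hle : t * ‖expInv ν μ c t u‖ ≤ u * ν * (C₁ * (u ^ (-(3 / 2) : ℝ) * Real.exp (-(A * u)))) +
      μ * (C₂ * (u ^ (-(1 / 2) : ℝ) * Real.exp (-(A * u)))) := by
    rw [h]
    refine (norm_add_le _ _).trans (add_le_add ?_ ?_)
    · rw [norm_mul, norm_mul, Complex.norm_real, Complex.norm_real, Real.norm_of_nonneg hu.le,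
        Real.norm_of_nonneg hν₀.le]
      gcongr
      exact h₁ u hu
    · rw [norm_mul, Complex.norm_real, Real.norm_of_nonneg hμ]
      gcongr
      exact h₂ u hu
  have e : u * u ^ (-(3 / 2) : ℝ) = u ^ (-1 / 2 : ℝ) := by
    nth_rewrite 1 [← Real.rpow_one u]
    rw [← Real.rpow_add hu]; norm_num
  have e' : (-(1 / 2) : ℝ) = -1 / 2 := by norm_num
  rw [e'] at hle
  rw [div_mul_eq_mul_div, le_div_iff₀ ht]
  linear_combination hle + ν * C₁ * Real.exp (-(A * u)) * e

theorem stronglyMeasurable_expInv (ν m c t : ℝ) : StronglyMeasurable (expInv ν m c t) := by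
  have h : StronglyMeasurable fun p : ℝ × ℝ =>
      expKernel ν m t p.1 ((c : ℂ) + (p.2 : ℂ) * Complex.I) := by
    apply Measurable.stronglyMeasurable
    unfold expKernel
    fun_prop
  rw [funext (expInv_eq ν m c t)]
  exact h.integral_prod_right'.const_mul _

/-! ### Laplace transform of a power and its inversion. -/

theorem integrableOn_rpow_mul_exp_neg {p a : ℝ} (hp : -1 < p) (ha : 0 < a) :
    IntegrableOn (fun u : ℝ => u ^ p * Real.exp (-(a * u))) (Ioi 0) := by
  simpa using integrableOn_rpow_mul_exp_neg_mul_rpow hp one_pos ha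

theorem norm_rpow_mul_cexp {p u : ℝ} (hu : 0 < u) (z : ℂ) :
    ‖((u ^ p : ℝ) : ℂ) * Complex.exp (-(u * z))‖ = u ^ p * Real.exp (-(z.re * u)) := by
  rw [norm_mul, Complex.norm_real, Real.norm_of_nonneg (by positivity), Complex.norm_exp]
  simp [mul_comm]

theorem integrableOn_rpow_mul_cexp {p : ℝ} (hp : -1 < p) {z : ℂ} (hz : 0 < z.re) :
    IntegrableOn (fun u : ℝ => ((u ^ p : ℝ) : ℂ) * Complex.exp (-(u * z))) (Ioi 0) := by
  refine (integrableOn_rpow_mul_exp_neg hp hz).mono' (by fun_prop) ?_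
  filter_upwards [ae_restrict_mem measurableSet_Ioi] with u hu
  exact (norm_rpow_mul_cexp hu z).le

theorem differentiableAt_integral_rpow_mul_cexp {p : ℝ} (hp : -1 < p) {z : ℂ} (hz : 0 < z.re) :
    DifferentiableAt ℂ (fun z : ℂ =>
      ∫ u in Ioi (0 : ℝ), ((u ^ p : ℝ) : ℂ) * Complex.exp (-(u * z))) z := by
  have hs : {w : ℂ | z.re / 2 < w.re} ∈ nhds z :=
    (isOpen_lt continuous_const Complex.continuous_re).mem_nhds (by simpa using by linarith)
  refine (hasDerivAt_integral_of_dominated_loc_of_deriv_le (s := {w : ℂ | z.re / 2 < w.re})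
    (F := fun z (u : ℝ) => ((u ^ p : ℝ) : ℂ) * Complex.exp (-(u * z)))
    (F' := fun z (u : ℝ) => ((u ^ p : ℝ) : ℂ) * (Complex.exp (-(u * z)) * -u))
    (bound := fun u => u ^ (p + 1) * Real.exp (-(z.re / 2 * u))) hs ?_
    (integrableOn_rpow_mul_cexp hp hz) (by fun_prop) ?_
    (integrableOn_rpow_mul_exp_neg (by linarith) (half_pos hz)) ?_).2.differentiableAt
  · exact Filter.Eventually.of_forall fun w => by fun_prop
  · filter_upwards [ae_restrict_mem measurableSet_Ioi] with u hu w hw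
    have hu : 0 < u := hu
    have hw : z.re / 2 < w.re := hw
    rw [← mul_assoc, norm_mul, norm_rpow_mul_cexp hu, norm_neg, Complex.norm_real,
      Real.norm_of_nonneg hu.le, mul_right_comm, Real.rpow_add hu, Real.rpow_one]
    gcongr
  · refine Filter.Eventually.of_forall fun u w _ => ?_
    have h : HasDerivAt (fun z : ℂ => -((u : ℂ) * z)) (-(u : ℂ)) w := by
      simpa using ((hasDerivAt_id w).const_mul (u : ℂ)).fun_neg
    exact h.cexp.const_mul _

/-- The Laplace transform of a power, on the whole right half-plane. -/
theorem integral_rpow_mul_cexp_neg_mul_Ioi {p : ℝ} (hp : -1 < p) {z : ℂ} (hz : 0 < z.re) :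
    ∫ u in Ioi (0 : ℝ), ((u ^ p : ℝ) : ℂ) * Complex.exp (-(u * z)) =
      Real.Gamma (p + 1) * z ^ (-((p + 1 : ℝ) : ℂ)) := by
  have hopen : IsOpen {z : ℂ | 0 < z.re} := isOpen_lt continuous_const Complex.continuous_re
  have hf : AnalyticOnNhd ℂ (fun z : ℂ =>
      ∫ u in Ioi (0 : ℝ), ((u ^ p : ℝ) : ℂ) * Complex.exp (-(u * z))) {z : ℂ | 0 < z.re} :=
    DifferentiableOn.analyticOnNhd (fun z hz =>
      (differentiableAt_integral_rpow_mul_cexp hp hz).differentiableWithinAt) hopen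
  have hg : AnalyticOnNhd ℂ (fun z : ℂ => Real.Gamma (p + 1) * z ^ (-((p + 1 : ℝ) : ℂ)))
      {z : ℂ | 0 < z.re} :=
    DifferentiableOn.analyticOnNhd (fun z hz => ((differentiableAt_id.cpow_const
      (mem_slitPlane_of_re_pos hz)).const_mul _).differentiableWithinAt) hopen
  -- Identity theorem: both sides are analytic in the half-plane and agree at real points
  -- accumulating at `1`, by the real Gamma integral.
  refine hf.eqOn_of_preconnected_of_frequently_eq hg
    (convex_halfSpace_re_gt 0).isPreconnected (z₀ := 1) (by simp) ?_ hz
  have htend : Filter.Tendsto (fun x : ℝ => (x : ℂ)) (nhdsWithin 1 (Ioi 1))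
      (nhdsWithin 1 {1}ᶜ) := by
    refine tendsto_nhdsWithin_iff.2 ⟨?_, ?_⟩
    · exact (Complex.continuous_ofReal.tendsto' 1 1 (by simp)).mono_left nhdsWithin_le_nhds
    · filter_upwards [self_mem_nhdsWithin] with x hx
      simpa using (ne_of_gt hx)
  refine htend.frequently (Filter.Eventually.frequently ?_)
  filter_upwards [self_mem_nhdsWithin] with x hx
  have hx : (0 : ℝ) < x := one_pos.trans hx
  have h := Real.integral_rpow_mul_exp_neg_mul_Ioi (by linarith : 0 < p + 1) hx
  rw [add_sub_cancel_right] at h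
  calc _ = ((∫ u in Ioi (0 : ℝ), u ^ p * Real.exp (-(x * u)) : ℝ) : ℂ) := by
        rw [← integral_complex_ofReal]
        refine integral_congr_ae (Filter.Eventually.of_forall fun u => ?_)
        push_cast
        rw [mul_comm (u : ℂ)]
    _ = _ := by
        rw [h, one_div, Real.inv_rpow hx.le, ← Real.rpow_neg hx.le, mul_comm]
        push_cast [Complex.ofReal_cpow hx.le]
        rfl

/-- The inverse Laplace transform of a power. -/
theorem integral_exp_mul_line_cpow {q c t : ℝ} (hq : 1 < q) (hc : 0 < c) (ht : 0 < t) :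
    (1 / (2 * (Real.pi : ℂ))) * ∫ y : ℝ, Complex.exp (((c : ℂ) + (y : ℂ) * Complex.I) * t) *
      ((c : ℂ) + (y : ℂ) * Complex.I) ^ (-(q : ℂ)) = ((t ^ (q - 1) / Real.Gamma q : ℝ) : ℂ) := by
  have hπ := Real.pi_pos
  -- The Fourier transform of `f` is the Laplace transform of the power on the line `Re s = c`,
  -- integrable as `q > 1`, so Fourier inversion applies at `t`.
  set f : ℝ → ℂ := (Ioi (0 : ℝ)).indicator
    (fun x : ℝ => ((x ^ (q - 1) : ℝ) : ℂ) * Complex.exp (-(x * (c : ℂ)))) with hf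
  have hfi : Integrable f :=
    (integrable_indicator_iff measurableSet_Ioi).2
      (integrableOn_rpow_mul_cexp (by linarith) (by simpa using hc))
  have hF : FourierTransform.fourier f = fun y : ℝ =>
      Real.Gamma q * ((c : ℂ) + ((2 * Real.pi * y : ℝ) : ℂ) * Complex.I) ^ (-(q : ℂ)) := by
    funext y
    have h := integral_rpow_mul_cexp_neg_mul_Ioi (p := q - 1) (by linarith)
      (z := (c : ℂ) + ((2 * Real.pi * y : ℝ) : ℂ) * Complex.I) (by simpa using hc)
    rw [sub_add_cancel] at h
    rw [← h, Real.fourier_eq', ← integral_indicator measurableSet_Ioi]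
    refine integral_congr_ae (Filter.Eventually.of_forall fun x => ?_)
    simp only [hf, smul_eq_mul]
    by_cases hx : x ∈ Ioi (0 : ℝ)
    · rw [indicator_of_mem hx, indicator_of_mem hx, mul_left_comm, ← Complex.exp_add]
      congr 2
      simp
      ring
    · simp [indicator_of_notMem hx]
  have hFi : Integrable (FourierTransform.fourier f) := by
    rw [hF]
    refine Integrable.const_mul ?_ _
    have h := (integrable_norm_line_rpow hc hq).comp_mul_left' (R := 2 * Real.pi) (by positivity)
    refine h.mono' (Measurable.aestronglyMeasurable (by fun_prop)) (Filter.Eventually.of_forall fun y => ?_)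
    rw [← Complex.ofReal_neg, Complex.norm_cpow_real]
  have hcont : ContinuousAt f t := by
    have h : ContinuousAt (fun x : ℝ => ((x ^ (q - 1) : ℝ) : ℂ) * Complex.exp (-(x * (c : ℂ)))) t :=
      (Complex.continuous_ofReal.continuousAt.comp
        (Real.continuousAt_rpow_const _ _ (Or.inl ht.ne'))).mul (by fun_prop)
    refine h.congr ?_
    filter_upwards [lt_mem_nhds ht] with x hx
    rw [hf, indicator_of_mem (mem_Ioi.2 hx)]
  have key := hfi.fourierInv_fourier_eq hFi hcont
  rw [hF, Real.fourierInv_eq', hf, indicator_of_mem (mem_Ioi.2 ht)] at key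
  have hΓ : (Real.Gamma q : ℂ) ≠ 0 :=
    Complex.ofReal_ne_zero.2 (Real.Gamma_pos_of_pos (by linarith)).ne'
  have hsub := Measure.integral_comp_mul_left (fun y : ℝ =>
    Complex.exp (((c : ℂ) + (y : ℂ) * Complex.I) * t) *
      ((c : ℂ) + (y : ℂ) * Complex.I) ^ (-(q : ℂ))) (2 * Real.pi)
  rw [abs_of_pos (by positivity)] at hsub
  have hexp : Complex.exp ((t : ℂ) * c) * Complex.exp (-((t : ℂ) * c)) = 1 := by
    rw [← Complex.exp_add]; simp
  have hval : ∫ y : ℝ, Complex.exp (((c : ℂ) + ((2 * Real.pi * y : ℝ) : ℂ) * Complex.I) * t) *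
      ((c : ℂ) + ((2 * Real.pi * y : ℝ) : ℂ) * Complex.I) ^ (-(q : ℂ)) =
      ((t ^ (q - 1) : ℝ) : ℂ) / Real.Gamma q := by
    rw [eq_div_iff hΓ]
    calc _ = Complex.exp ((t : ℂ) * c) * (((t ^ (q - 1) : ℝ) : ℂ) * Complex.exp (-(t * (c : ℂ)))) := by
          rw [← key, ← integral_mul_const, ← integral_const_mul]
          refine integral_congr_ae (Filter.Eventually.of_forall fun y => ?_)
          simp only [smul_eq_mul]
          rw [mul_right_comm, mul_comm _ (_ ^ (-(q : ℂ))), ← mul_assoc (Complex.exp (t * c)),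
            ← Complex.exp_add, add_mul]
          have : (c : ℂ) * t + ((2 * Real.pi * y : ℝ) : ℂ) * Complex.I * t =
            t * c + ((2 * Real.pi * inner ℝ y t : ℝ) : ℂ) * Complex.I := by
            simp
            ring
          rw [this]
          ring
      _ = _ := by linear_combination ((t ^ (q - 1) : ℝ) : ℂ) * hexp
  rw [hval] at hsub
  rw [Complex.ofReal_div, hsub, Complex.real_smul, one_div]
  push_cast
  rfl

/-! ### Moments in `u` and integration of superpositions. -/

theorem re_cpow_pos {ν : ℝ} (hν₀ : 0 < ν) (hν₁ : ν < 1) {s : ℂ} (hs : 0 < s.re) :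
    0 < (s ^ (ν : ℂ)).re := by
  have := norm_pos_of_re_pos hs
  have := cos_half_pos hν₀ hν₁
  exact lt_of_lt_of_le (by positivity) (cos_mul_norm_rpow_le_re_cpow hν₀ hν₁ hs)

theorem cpow_cpow_of_re_pos {ν : ℝ} (hν₀ : 0 < ν) (hν₁ : ν < 1) {s : ℂ} (hs : 0 < s.re) (z : ℂ) :
    (s ^ (ν : ℂ)) ^ z = s ^ (ν * z) := by
  have h := abs_lt.1 (Complex.abs_arg_lt_pi_div_two_iff.2 (Or.inl hs))
  have hpi := Real.pi_pos
  have him : (Complex.log s * (ν : ℂ)).im = s.arg * ν := by simp [Complex.log_im]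
  rw [Complex.cpow_mul] <;> rw [him] <;> nlinarith

/-- Integrating the norm over `u` gives a multiple of `(s ^ ν).re ^ (-(p + 1))`, so the line
integrand is `O(‖s‖ ^ (-(μ + ν * (p + 1))))`. -/
theorem integrable_rpow_mul_expKernel {ν : ℝ} (hν₀ : 0 < ν) (hν₁ : ν < 1) {p μ c : ℝ} (t : ℝ)
    (hp : -1 < p) (hq : 1 < μ + ν * (p + 1)) (hc : 0 < c) :
    Integrable (fun x : ℝ × ℝ => ((x.1 ^ p : ℝ) : ℂ) *
      expKernel ν μ t x.1 ((c : ℂ) + (x.2 : ℂ) * Complex.I))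
      ((volume.restrict (Ioi 0)).prod volume) := by
  have hm : AEStronglyMeasurable (fun x : ℝ × ℝ => ((x.1 ^ p : ℝ) : ℂ) *
      expKernel ν μ t x.1 ((c : ℂ) + (x.2 : ℂ) * Complex.I))
      ((volume.restrict (Ioi 0)).prod volume) := by
    apply Measurable.aestronglyMeasurable
    unfold expKernel
    fun_prop
  have hs : ∀ y : ℝ, 0 < ((c : ℂ) + (y : ℂ) * Complex.I).re := fun y => by simpa using hc
  have hk := cos_half_pos hν₀ hν₁
  rw [integrable_prod_iff' hm]
  constructor
  · refine Filter.Eventually.of_forall fun y => ?_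
    have h := (integrableOn_rpow_mul_cexp hp (re_cpow_pos hν₀ hν₁ (hs y))).const_mul
      (Complex.exp (((c : ℂ) + (y : ℂ) * Complex.I) * t) /
        ((c : ℂ) + (y : ℂ) * Complex.I) ^ (μ : ℂ))
    refine h.congr (Filter.Eventually.of_forall fun u => ?_)
    simp only [expKernel]
    ring
  · refine ((integrable_norm_line_rpow hc hq).const_mul (Real.exp (c * t) *
      (Real.cos (Real.pi / 2 * ν) ^ (-(p + 1)) * Real.Gamma (p + 1)))).mono'
      hm.norm.prod_swap.integral_prod_right' (Filter.Eventually.of_forall fun y => ?_)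
    rw [Real.norm_of_nonneg (integral_nonneg fun _ => norm_nonneg _)]
    have hre := re_cpow_pos hν₀ hν₁ (hs y)
    have hle := cos_mul_norm_rpow_le_re_cpow hν₀ hν₁ (hs y)
    have hn := norm_pos_of_re_pos (hs y)
    have hc' := re_line c y
    simp only [norm_mul, norm_expKernel, hc']
    set s := (c : ℂ) + (y : ℂ) * Complex.I
    have hI := Real.integral_rpow_mul_exp_neg_mul_Ioi (by linarith : 0 < p + 1) hre
    rw [add_sub_cancel_right, one_div, Real.inv_rpow hre.le, ← Real.rpow_neg hre.le] at hI
    have hΓ : 0 < Real.Gamma (p + 1) := Real.Gamma_pos_of_pos (by linarith)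
    calc _ = ∫ u in Ioi (0 : ℝ), Real.exp (c * t) * ‖s‖ ^ (-μ) *
          (u ^ p * Real.exp (-((s ^ (ν : ℂ)).re * u))) := by
          refine setIntegral_congr_fun measurableSet_Ioi fun u hu => ?_
          have hu : 0 < u := hu
          rw [Complex.norm_real, Real.norm_of_nonneg (by positivity), mul_comm u]
          ring
      _ = Real.exp (c * t) * ‖s‖ ^ (-μ) *
          ((s ^ (ν : ℂ)).re ^ (-(p + 1)) * Real.Gamma (p + 1)) := by
          rw [integral_const_mul, hI]
      _ ≤ Real.exp (c * t) * ‖s‖ ^ (-μ) *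
          ((Real.cos (Real.pi / 2 * ν) * ‖s‖ ^ ν) ^ (-(p + 1)) * Real.Gamma (p + 1)) := by
          have := Real.rpow_le_rpow_of_nonpos (by positivity) hle (by linarith : -(p + 1) ≤ 0)
          gcongr
      _ = _ := by
          rw [Real.mul_rpow hk.le (by positivity), ← Real.rpow_mul hn.le,
            neg_add μ, Real.rpow_add hn, mul_neg]
          ring

theorem integral_rpow_mul_expInv_of_one_lt {ν : ℝ} (hν₀ : 0 < ν) (hν₁ : ν < 1) {p μ c t : ℝ}
    (hp : -1 < p) (hq : 1 < μ + ν * (p + 1)) (hc : 0 < c) (ht : 0 < t) :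
    IntegrableOn (fun u : ℝ => ((u ^ p : ℝ) : ℂ) * expInv ν μ c t u) (Ioi 0) ∧
      ∫ u in Ioi (0 : ℝ), ((u ^ p : ℝ) : ℂ) * expInv ν μ c t u =
        ((Real.Gamma (p + 1) * (t ^ (μ + ν * (p + 1) - 1) / Real.Gamma (μ + ν * (p + 1))) : ℝ) :
          ℂ) := by
  have hint := integrable_rpow_mul_expKernel hν₀ hν₁ t hp hq hc
  have heq : ∀ u : ℝ, ((u ^ p : ℝ) : ℂ) * expInv ν μ c t u = (1 / (2 * (Real.pi : ℂ))) *
      ∫ y : ℝ, ((u ^ p : ℝ) : ℂ) * expKernel ν μ t u ((c : ℂ) + (y : ℂ) * Complex.I) := fun u => by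
    rw [expInv_eq, integral_const_mul]
    ring
  simp only [heq]
  refine ⟨hint.integral_prod_left.const_mul _, ?_⟩
  rw [integral_const_mul, integral_integral_swap hint, Complex.ofReal_mul,
    ← integral_exp_mul_line_cpow hq hc ht, mul_left_comm,
    ← integral_const_mul (Real.Gamma (p + 1) : ℂ)]
  refine congrArg ((1 / (2 * (Real.pi : ℂ))) * ·)
    (integral_congr_ae (Filter.Eventually.of_forall fun y => ?_))
  have hs : 0 < ((c : ℂ) + (y : ℂ) * Complex.I).re := by simpa using hc
  simp only
  set s := (c : ℂ) + (y : ℂ) * Complex.I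
  have hs0 : s ≠ 0 := Complex.slitPlane_ne_zero (mem_slitPlane_of_re_pos hs)
  calc _ = ∫ u in Ioi (0 : ℝ), Complex.exp (s * t) * s ^ (-(μ : ℂ)) *
        (((u ^ p : ℝ) : ℂ) * Complex.exp (-(u * s ^ (ν : ℂ)))) := by
        refine integral_congr_ae (Filter.Eventually.of_forall fun u => ?_)
        simp only [expKernel, Complex.cpow_neg]
        ring
    _ = _ := by
        rw [integral_const_mul, integral_rpow_mul_cexp_neg_mul_Ioi hp (re_cpow_pos hν₀ hν₁ hs),
          cpow_cpow_of_re_pos hν₀ hν₁ hs]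
        push_cast
        rw [neg_add (μ : ℂ), Complex.cpow_add _ _ hs0, mul_neg]
        ring

/-- The moments of the inversion integral in the variable `u`. -/
theorem integral_rpow_mul_expInv {ν : ℝ} (hν₀ : 0 < ν) (hν₁ : ν < 1) {p μ c t : ℝ} (hp : -1 < p)
    (hq : 0 < μ + ν * (p + 1)) (hc : 0 < c) (ht : 0 < t) :
    ∫ u in Ioi (0 : ℝ), ((u ^ p : ℝ) : ℂ) * expInv ν μ c t u =
      ((Real.Gamma (p + 1) * (t ^ (μ + ν * (p + 1) - 1) / Real.Gamma (μ + ν * (p + 1))) : ℝ) :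
        ℂ) := by
  set q := μ + ν * (p + 1) with hqdef
  have e₁ : μ + 1 - ν + ν * (p + 1 + 1) = q + 1 := by rw [hqdef]; ring
  have e₂ : μ + 1 + ν * (p + 1) = q + 1 := by rw [hqdef]; ring
  obtain ⟨i₁, h₁⟩ := integral_rpow_mul_expInv_of_one_lt hν₀ hν₁ (p := p + 1) (μ := μ + 1 - ν)
    (by linarith) (by rw [e₁]; linarith) hc ht
  obtain ⟨i₂, h₂⟩ := integral_rpow_mul_expInv_of_one_lt hν₀ hν₁ (p := p) (μ := μ + 1)
    hp (by rw [e₂]; linarith) hc ht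
  have ht' : (t : ℂ) ≠ 0 := Complex.ofReal_ne_zero.2 ht.ne'
  -- After multiplication by `t`, the recurrence yields two moments of order `q + 1 > 1`, covered by
  -- the absolutely convergent case.
  rw [← mul_right_inj' ht', ← integral_const_mul]
  calc _ = ∫ u in Ioi (0 : ℝ), (ν * (((u ^ (p + 1) : ℝ) : ℂ) * expInv ν (μ + 1 - ν) c t u) +
        μ * (((u ^ p : ℝ) : ℂ) * expInv ν (μ + 1) c t u)) := by
        refine setIntegral_congr_fun measurableSet_Ioi fun u hu => ?_
        have hu : 0 < u := hu
        have h := mul_expInv hν₀ hν₁ μ t hu hc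
        rw [Real.rpow_add hu, Real.rpow_one]
        push_cast
        linear_combination ((u ^ p : ℝ) : ℂ) * h
    _ = _ := by
        rw [integral_add (i₁.const_mul _) (i₂.const_mul _), integral_const_mul, integral_const_mul,
          h₁, h₂, e₁, e₂, Real.Gamma_add_one (by linarith : p + 1 ≠ 0), Real.Gamma_add_one hq.ne',
          add_sub_cancel_right, Real.rpow_sub_one ht.ne']
        have := (Real.Gamma_pos_of_pos hq).ne'
        have := hq.ne'
        norm_cast
        field_simp
        rw [hqdef]
        ring

/-- Integration of a weighted Volterra function against the inversion integral. -/
theorem ExpWeight.integral_weightedVolterra_mul_expInv {w : ℝ → ℝ} (hw : ExpWeight w) {ν : ℝ}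
    (hν₀ : 0 < ν) (hν₁ : ν < 1) {b μ c t : ℝ} (hb : 0 ≤ b) (hμ : 0 ≤ μ) (hc : 0 < c)
    (ht : 0 < t) :
    IntegrableOn (fun u : ℝ => (weightedVolterra w b u : ℂ) * expInv ν μ c t u) (Ioi 0) ∧
      ∫ u in Ioi (0 : ℝ), (weightedVolterra w b u : ℂ) * expInv ν μ c t u =
        ((1 / ν * weightedVolterra (fun x => w (x / ν)) (ν * (b + 1) + μ - 1) t : ℝ) : ℂ) := by
  obtain ⟨B, hB⟩ := hw.integrable_prod hb
  -- The rate `|B| + 1` leaves a factor `exp (-u)` after the growth `exp (B * u)` is absorbed.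
  obtain ⟨C, hC⟩ := exists_norm_expInv_le hν₀ hν₁ hμ ht (by positivity : 0 < |B| + 1) hc
  have hm := (stronglyMeasurable_expInv ν μ c t).aestronglyMeasurable
    (μ := volume.restrict (Ioi 0))
  have hint := hB (expInv ν μ c t) (Ioi 0) measurableSet_Ioi subset_rfl hm (by
    refine ((integrableOn_rpow_mul_exp_neg (p := -1 / 2) (by norm_num) one_pos).const_mul C).mono'
      (hm.norm.mul (by fun_prop)) ?_
    filter_upwards [ae_restrict_mem measurableSet_Ioi] with u hu
    have hu : 0 < u := hu
    rw [Real.norm_of_nonneg (by positivity)]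
    calc _ ≤ C * (u ^ (-1 / 2 : ℝ) * Real.exp (-((|B| + 1) * u))) * Real.exp (|B| * u) := by
          have := le_abs_self B
          have := hC u hu
          have := (norm_nonneg _).trans this
          gcongr
      _ = _ := by
          rw [mul_assoc, mul_assoc, ← Real.exp_add]
          ring_nf)
  have hV : ∀ u, ∫ x in Ioi (0 : ℝ), expInv ν μ c t u *
      ((w x * (u ^ (x + b) / Real.Gamma (x + b + 1)) : ℝ) : ℂ) =
      (weightedVolterra w b u : ℂ) * expInv ν μ c t u := fun u => by
    rw [integral_const_mul, integral_complex_ofReal, weightedVolterra, mul_comm]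
  simp only [← hV]
  refine ⟨hint.integral_prod_left, ?_⟩
  rw [integral_integral_swap hint]
  have hsub := integral_comp_mul_left_Ioi (fun x => w (x / ν) *
    (t ^ (x + (ν * (b + 1) + μ - 1)) / Real.Gamma (x + (ν * (b + 1) + μ - 1) + 1))) 0 hν₀
  rw [mul_zero, smul_eq_mul, ← one_div] at hsub
  rw [weightedVolterra, ← hsub, ← integral_complex_ofReal]
  refine setIntegral_congr_fun measurableSet_Ioi fun x hx => ?_
  have hx : 0 < x := hx
  have hpos : 0 < μ + ν * (x + b + 1) := by positivity
  have hmom := integral_rpow_mul_expInv hν₀ hν₁ (by linarith : -1 < x + b) hpos hc ht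
  have hΓ : (Real.Gamma (x + b + 1) : ℂ) ≠ 0 :=
    Complex.ofReal_ne_zero.2 (Real.Gamma_pos_of_pos (by linarith)).ne'
  calc _ = ∫ u in Ioi (0 : ℝ), ((w x : ℂ) / Real.Gamma (x + b + 1)) *
        (((u ^ (x + b) : ℝ) : ℂ) * expInv ν μ c t u) := by
        refine integral_congr_ae (Filter.Eventually.of_forall fun u => ?_)
        push_cast
        ring
    _ = _ := by
        rw [integral_const_mul, hmom, mul_div_cancel_left₀ _ hν₀.ne']
        have e : ν * x + (ν * (b + 1) + μ - 1) = μ + ν * (x + b + 1) - 1 := by ring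
        rw [e, sub_add_cancel]
        push_cast
        field_simp

/-! ### Volterra weights and their rescaling. -/

theorem expWeight_rpow_mul {β : ℝ} (hβ : -1 < β) (A : ℝ) {κ : ℝ} (hκ : 0 < κ) (b : ℝ) :
    ExpWeight fun x => A * x ^ β * κ ^ (x + b) := by
  refine ⟨Real.log κ + 1, ?_⟩
  have h := (integrableOn_rpow_mul_exp_neg hβ one_pos).const_mul (A * κ ^ b)
  refine IntegrableOn.congr_fun h (fun x _ => ?_) measurableSet_Ioi
  have e : κ ^ x = Real.exp (Real.log κ * x) := Real.rpow_def_of_pos hκ x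
  have e' : Real.exp (-(Real.log κ + 1) * x) =
      Real.exp (-(1 * x)) * (Real.exp (Real.log κ * x))⁻¹ := by
    rw [← Real.exp_neg, ← Real.exp_add]
    ring_nf
  have := Real.exp_pos (Real.log κ * x)
  simp only
  rw [Real.rpow_add hκ, e, e']
  field_simp

/-- The weight of the Volterra function `t ↦ μ(κt, β, b)`; for `β = 0` it is that of `ν(κt, b)`. -/
def volterraWeight (β κ b x : ℝ) : ℝ :=
  (Real.Gamma (β + 1))⁻¹ * x ^ β * κ ^ (x + b)

theorem expWeight_volterraWeight {β κ : ℝ} (hβ : -1 < β) (hκ : 0 < κ) (b : ℝ) :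
    ExpWeight (volterraWeight β κ b) :=
  expWeight_rpow_mul hβ _ hκ b

theorem volterraMu_mul {κ t : ℝ} (hκ : 0 < κ) (ht : 0 ≤ t) (β b : ℝ) :
    volterraMu (κ * t) β b = weightedVolterra (volterraWeight β κ b) b t := by
  unfold volterraMu weightedVolterra volterraWeight
  refine setIntegral_congr_fun measurableSet_Ioi fun x _ => ?_
  simp only [Real.mul_rpow hκ.le ht, div_eq_mul_inv, mul_inv]
  ring

theorem volterraNu₂_eq_volterraMu (t b : ℝ) : volterraNu₂ t b = volterraMu t 0 b := by
  simp [volterraNu₂, volterraMu]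

theorem volterraNu_eq_volterraMu (t : ℝ) : volterraNu t = volterraMu t 0 0 := by
  simp [volterraNu, volterraMu]

/-- Splitting off `lam ^ (b - d)` leaves `d` free: it selects the index `d * ν` of the Volterra
function on the right, and thereby the order of `⋆`. -/
theorem volterraWeight_div {ν lam x : ℝ} (hν : 0 < ν) (hlam : 0 < lam) (hx : 0 < x) (β b d : ℝ) :
    volterraWeight β lam b (x / ν) =
      (lam ^ (b - d) / ν ^ β) * volterraWeight β (lam ^ (1 / ν)) (d * ν) x := by
  unfold volterraWeight
  have e : lam ^ (x / ν + b) = lam ^ (b - d) * lam ^ (1 / ν * (x + d * ν)) := by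
    rw [← Real.rpow_add hlam]
    congr 1
    field_simp
    ring
  rw [Real.div_rpow hx.le hν.le, ← Real.rpow_mul hlam.le, e]
  ring

theorem powerConv_congr {a : ℝ} {g h : ℝ → ℝ} (hgh : ∀ t, 0 < t → g t = h t) {t : ℝ} (ht : 0 < t) :
    powerConv a g t = powerConv a h t := by
  refine Filter.EventuallyEq.iteratedDeriv_eq _ ?_
  filter_upwards [lt_mem_nhds ht] with s hs
  rw [laplaceConv, laplaceConv, intervalIntegral.integral_of_le hs.le,
    intervalIntegral.integral_of_le hs.le]
  refine setIntegral_congr_fun measurableSet_Ioc fun τ hτ => ?_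
  simp only [hgh τ hτ.1]

theorem powerConvExists_congr {a : ℝ} {g h : ℝ → ℝ} (hgh : ∀ t, 0 < t → g t = h t)
    (hg : PowerConvExists a g) : PowerConvExists a h := by
  refine ⟨fun t ht => (hg.1 t ht).congr ?_, hg.2.congr fun t ht => ?_⟩
  · rw [uIoc_of_le ht.le]
    exact fun τ hτ => by simp only [hgh τ hτ.1]
  · have ht : 0 < t := ht
    rw [laplaceConv, laplaceConv, intervalIntegral.integral_of_le ht.le,
      intervalIntegral.integral_of_le ht.le]
    refine setIntegral_congr_fun measurableSet_Ioc fun τ hτ => ?_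
    simp only [hgh τ hτ.1]

/-- Integration of `μ(λu, β, b)` against the inversion integral, with the result expressed through
`μ(λ^(1/ν) t, β, d ν)` for any `d ≥ 0`. -/
theorem volterraMu_expInv {ν μ lam β b d c : ℝ} (hν₀ : 0 < ν) (hν₁ : ν < 1) (hμ : 0 ≤ μ)
    (hlam : 0 < lam) (hβ : -1 < β) (hb : 0 ≤ b) (hd : 0 ≤ d) (hc : 0 < c) :
    PowerConvExists (ν * (b + 1 - d) + μ - 1)
        (fun τ => volterraMu (lam ^ (1 / ν) * τ) β (d * ν)) ∧
      ∀ t : ℝ, 0 < t →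
        IntegrableOn (fun u : ℝ => (volterraMu (lam * u) β b : ℂ) * expInv ν μ c t u) (Ioi 0) ∧
        ∫ u in Ioi (0 : ℝ), (volterraMu (lam * u) β b : ℂ) * expInv ν μ c t u =
          ((lam ^ (b - d) / ν ^ (β + 1) * powerConv (ν * (b + 1 - d) + μ - 1)
            (fun τ => volterraMu (lam ^ (1 / ν) * τ) β (d * ν)) t : ℝ) : ℂ) := by
  have hκ : 0 < lam ^ (1 / ν) := by positivity
  have hw := expWeight_volterraWeight hβ hκ (d * ν)
  have hdν : 0 ≤ d * ν := by positivity
  have hpos : 0 < d * ν + (ν * (b + 1 - d) + μ - 1) + 1 := by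
    have : 0 < ν * (b + 1) := by positivity
    linarith
  have hV : ∀ t, 0 < t → weightedVolterra (volterraWeight β (lam ^ (1 / ν)) (d * ν)) (d * ν) t =
      volterraMu (lam ^ (1 / ν) * t) β (d * ν) := fun t ht => (volterraMu_mul hκ ht.le _ _).symm
  refine ⟨powerConvExists_congr hV (hw.powerConvExists hdν hpos), fun t ht => ?_⟩
  obtain ⟨h₁, h₂⟩ := (expWeight_volterraWeight hβ hlam b).integral_weightedVolterra_mul_expInv
    hν₀ hν₁ hb hμ hc ht
  have hcongr : EqOn (fun u : ℝ =>
      (weightedVolterra (volterraWeight β lam b) b u : ℂ) * expInv ν μ c t u)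
      (fun u : ℝ => (volterraMu (lam * u) β b : ℂ) * expInv ν μ c t u) (Ioi 0) := fun u hu => by
    simp only [volterraMu_mul hlam (le_of_lt hu)]
  refine ⟨h₁.congr_fun hcongr measurableSet_Ioi, ?_⟩
  rw [← setIntegral_congr_fun measurableSet_Ioi hcongr, h₂, ← powerConv_congr hV ht,
    hw.powerConv_weightedVolterra hdν hpos ht, Complex.ofReal_inj]
  have e : d * ν + (ν * (b + 1 - d) + μ - 1) = ν * (b + 1) + μ - 1 := by ring
  have hscale : weightedVolterra (fun x => volterraWeight β lam b (x / ν)) (ν * (b + 1) + μ - 1) t =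
      (lam ^ (b - d) / ν ^ β) * weightedVolterra (volterraWeight β (lam ^ (1 / ν)) (d * ν))
        (ν * (b + 1) + μ - 1) t := by
    unfold weightedVolterra
    rw [← integral_const_mul]
    refine setIntegral_congr_fun measurableSet_Ioi fun x hx => ?_
    simp only [volterraWeight_div hν₀ hlam hx β b d, mul_assoc]
  rw [e, hscale, Real.rpow_add hν₀, Real.rpow_one]
  have : 0 < ν ^ β := by positivity
  field_simp

end

theorem mainTheorem10 (ν μ lam ρ ξ c : ℝ) (hν₀ : 0 < ν) (hν₁ : ν < 1) (hμ : 0 ≤ μ)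
    (hlam : 0 < lam) (hρ : 0 < ρ) (hξ : 0 < ξ) (hc : 0 < c) :
    (PowerConvExists (ν + μ - 1) (fun τ => volterraNu (lam ^ (1 / ν) * τ)) ∧
      ∀ t : ℝ, 0 < t →
        IntegrableOn (fun u : ℝ => (volterraNu (lam * u) : ℂ) * expInv ν μ c t u) (Ioi 0) ∧
        ∫ u in Ioi (0 : ℝ), (volterraNu (lam * u) : ℂ) * expInv ν μ c t u =
          ((1 / ν * powerConv (ν + μ - 1)
            (fun τ => volterraNu (lam ^ (1 / ν) * τ)) t : ℝ) : ℂ)) ∧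
    (PowerConvExists (μ - 1) (fun τ => volterraNu₂ (lam ^ (1 / ν) * τ) ((ρ + 1) * ν)) ∧
      ∀ t : ℝ, 0 < t →
        IntegrableOn (fun u : ℝ => (volterraNu₂ (lam * u) ρ : ℂ) * expInv ν μ c t u) (Ioi 0) ∧
        ∫ u in Ioi (0 : ℝ), (volterraNu₂ (lam * u) ρ : ℂ) * expInv ν μ c t u =
          ((1 / (ν * lam) * powerConv (μ - 1)
            (fun τ => volterraNu₂ (lam ^ (1 / ν) * τ) ((ρ + 1) * ν)) t : ℝ) : ℂ)) ∧
    (PowerConvExists (μ - 1) (fun τ => volterraMu (lam ^ (1 / ν) * τ) ξ ((ρ + 1) * ν)) ∧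
      ∀ t : ℝ, 0 < t →
        IntegrableOn (fun u : ℝ => (volterraMu (lam * u) ξ ρ : ℂ) * expInv ν μ c t u) (Ioi 0) ∧
        ∫ u in Ioi (0 : ℝ), (volterraMu (lam * u) ξ ρ : ℂ) * expInv ν μ c t u =
          ((1 / (lam * ν ^ (ξ + 1)) * powerConv (μ - 1)
            (fun τ => volterraMu (lam ^ (1 / ν) * τ) ξ ((ρ + 1) * ν)) t : ℝ) : ℂ)) := by
  refine ⟨?_, ?_, ?_⟩
  · have h := volterraMu_expInv (β := 0) (b := 0) (d := 0) hν₀ hν₁ hμ hlam (by norm_num) le_rfl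
      le_rfl hc
    simpa only [volterraNu_eq_volterraMu, zero_mul, zero_add, sub_zero, mul_one, Real.rpow_zero,
      Real.rpow_one] using h
  -- With `d = ρ + 1` the term `ν * (b + 1 - d)` vanishes, so the order of `⋆` is `μ - 1` and the
  -- constant contains `lam ^ (-1)`.
  · have h := volterraMu_expInv (β := 0) (b := ρ) (d := ρ + 1) hν₀ hν₁ hμ hlam (by norm_num) hρ.le
      (by positivity) hc
    have e : lam ^ (ρ - (ρ + 1)) / ν ^ (1 : ℝ) = 1 / (ν * lam) := by
      rw [sub_add_cancel_left, Real.rpow_neg_one, Real.rpow_one]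
      field_simp
    simpa only [volterraNu₂_eq_volterraMu, e, sub_self, mul_zero, zero_add] using h
  · have h := volterraMu_expInv (β := ξ) (b := ρ) (d := ρ + 1) hν₀ hν₁ hμ hlam (by linarith) hρ.le
      (by positivity) hc
    have e : lam ^ (ρ - (ρ + 1)) / ν ^ (ξ + 1) = 1 / (lam * ν ^ (ξ + 1)) := by
      have : 0 < ν ^ (ξ + 1) := by positivity
      rw [sub_add_cancel_left, Real.rpow_neg_one]
      field_simp
    simpa only [e, sub_self, mul_zero, zero_add] using h
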